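/- Let $k$ be a subfield of $\mathbb{R}$ and let $K$ be its real closure in $\mathbb{R}$, that is, the field of all real numbers algebraic over $k$. For a power series $f(X)=\sum_{j\ge 0} a_jX^j$ with complex coefficients let $R(f)\in[0,\infty]$ be its convergence radius, i.e. the supremum of all real $r>0$ such that $f$ converges on $\{z\in\mathbb{C}: |z|<r\}$ (with $\sup\emptyset=0$). For a Puiseux series $g(X)=\sum_{j\ge l} a_jX^{j/p}$ with complex coefficients, where $l\in\mathbb{Z}$ and $p\ge 1$ is an integer, the convergence radius is $R(g):=R(f)^p$ where $f(X)=\sum_{j\ge 0}a_jX^j$ (with $a_j=0$ for $j<l$ and $\infty^p=\infty$). If $g$ is algebraic over $k[X]$, i.e. if there is a nonzero polynomial $P(X,T)\in k[X,T]$ with $P(X,g(X))=0$, then $R(g)\in K_{>0}\cup\{\infty\}$; that is, $R(g)=\infty$ or $R(g)$ is a positive real number belonging to $K$. -/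

import Mathlib

open scoped ENNReal Polynomial

/-- The relevant radii of a univariate complex power series `f`: all real `r > 0` such that
`f` converges on the open disc `B(0, r)`. -/
def relevantRadii (f : PowerSeries ℂ) : Set ℝ :=
  {r | 0 < r ∧ ∀ z ∈ Metric.ball (0 : ℂ) r, Summable fun n : ℕ => PowerSeries.coeff n f * z ^ n}

/-- The convergence radius of a univariate complex power series, the supremum of the relevant
radii in `[0, ∞]` (with `sup ∅ = 0`). -/
noncomputable def powerSeriesRadius (f : PowerSeries ℂ) : ℝ≥0∞ :=
  ⨆ r ∈ relevantRadii f, ENNReal.ofReal r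

/-- `g` is a Puiseux series of the form `∑_{k ≥ l} a_k X^{k/p}` with `l ∈ ℤ` and a natural
number `p ≥ 1`. Such a series is an element of the field of Hahn series with exponents in `ℚ`
and coefficients in `ℂ`. -/
def IsPuiseuxSeries (p : ℕ) (g : HahnSeries ℚ ℂ) : Prop :=
  0 < p ∧ ∃ l : ℤ, ∀ q ∈ g.support, ∃ k : ℤ, l ≤ k ∧ q = (k : ℚ) / (p : ℚ)

/-- The convergence radius `R(g) = R(f) ^ p` of `g = ∑_{k ≥ l} a_k X^{k/p}`, where
`f = ∑_{k ≥ 0} a_k X^k`. -/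
noncomputable def puiseuxRadius (p : ℕ) (g : HahnSeries ℚ ℂ) : ℝ≥0∞ :=
  powerSeriesRadius (PowerSeries.mk fun k : ℕ => g.coeff ((k : ℚ) / (p : ℚ))) ^ p

/-- The inclusion of `k[X]` into the Hahn series with exponents in `ℚ` and coefficients in `ℂ`;
it sends `X` to the series `X ^ 1`. -/
noncomputable def polyToHahn (k : Subfield ℝ) : k[X] →+* HahnSeries ℚ ℂ :=
  Polynomial.eval₂RingHom
    ((HahnSeries.C : ℂ →+* HahnSeries ℚ ℂ).comp (Complex.ofRealHom.comp k.subtype))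
    (HahnSeries.single (1 : ℚ) (1 : ℂ))

/-- `g` is algebraic over `k[X]`: `P(X, g(X)) = 0` for some nonzero `P ∈ k[X][T]`. -/
def IsAlgebraicOverPolynomials (k : Subfield ℝ) (g : HahnSeries ℚ ℂ) : Prop :=
  ∃ P : k[X][X], P ≠ 0 ∧ P.eval₂ (polyToHahn k) g = 0

/-- The real closure in `ℝ` of a subfield `k` of `ℝ`: the field of all real numbers that are
algebraic over `k`. -/
noncomputable def realClosureInReal (k : Subfield ℝ) : IntermediateField k ℝ :=
  algebraicClosure k ℝ

/-! Multiplying `g` by a power of `X^(1/p)` and replacing `X` by `X^p` reduces to a power series `F`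
algebraic over `k[X]`. Choose `P` with `P(F) = 0` and `P_T(F) ≠ 0`; since `P_T(F)` is itself
algebraic, some `B(F) * P_T(F) = D` is a nonzero polynomial in `k[X]`
(`IsAlgebraic.exists_aeval_derivative_dvd`). This `D` plays the role of a discriminant.

Suppose the radius `R` is finite and `lc(P) * D` has no zero on `|z| = R`. On a closed annulus up to
that circle, roots of `P(z, ·)` are bounded, and `|P_T(z, f(z))|` is bounded below for `|z| < R`. A
formal implicit function theorem with uniform constants (`exists_geometric_bound_of_sum_eq_zero`)
then bounds the Taylor coefficients of `f` at all such `z` by a fixed multiple of `ρ^(-n)`. Cauchy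
estimates carry this back to the origin (`norm_coeff_mul_add_pow_le`) and give convergence beyond
`R`, a contradiction. Hence `R = |z|` for a root `z` of `lc(P) * D`, and `|z|² = z * conj z` is
algebraic over `k`.

Positivity of `R` comes from the same implicit function theorem, after a Hensel-type substitution
that makes the linear part invertible (`exists_mem_relevantRadii`). No analytic continuation or
monodromy is needed. -/

/-! ### Submultiplicative norms on truncated power series. -/

/-- The norm `∑ ‖aₙ‖ ρⁿ` of the truncation of a power series to its first `N` coefficients. -/
noncomputable def truncNorm (ρ : ℝ) (N : ℕ) (f : PowerSeries ℂ) : ℝ :=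
  ∑ n ∈ Finset.range N, ‖PowerSeries.coeff n f‖ * ρ ^ n

section truncNorm

variable {ρ : ℝ} (hρ : 0 ≤ ρ)
include hρ

theorem truncNorm_nonneg (N : ℕ) (f : PowerSeries ℂ) : 0 ≤ truncNorm ρ N f :=
  Finset.sum_nonneg fun _ _ => by positivity

theorem truncNorm_add_le (N : ℕ) (f g : PowerSeries ℂ) :
    truncNorm ρ N (f + g) ≤ truncNorm ρ N f + truncNorm ρ N g := by
  rw [truncNorm, truncNorm, truncNorm, ← Finset.sum_add_distrib]
  refine Finset.sum_le_sum fun n _ => ?_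
  rw [← add_mul, map_add]
  gcongr
  exact norm_add_le _ _

theorem truncNorm_sum_le {ι : Type*} (s : Finset ι) (N : ℕ) (f : ι → PowerSeries ℂ) :
    truncNorm ρ N (∑ i ∈ s, f i) ≤ ∑ i ∈ s, truncNorm ρ N (f i) := by
  classical
  induction s using Finset.induction_on with
  | empty => simp [truncNorm]
  | insert a s ha ih =>
    rw [Finset.sum_insert ha, Finset.sum_insert ha]
    exact (truncNorm_add_le hρ N _ _).trans (by gcongr)

theorem truncNorm_mul_le (N : ℕ) (f g : PowerSeries ℂ) :
    truncNorm ρ N (f * g) ≤ truncNorm ρ N f * truncNorm ρ N g := by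
  set u : ℕ → ℝ := fun n => ‖PowerSeries.coeff n f‖ * ρ ^ n with hu
  set v : ℕ → ℝ := fun n => ‖PowerSeries.coeff n g‖ * ρ ^ n with hv
  calc truncNorm ρ N (f * g)
      ≤ ∑ n ∈ Finset.range N, ∑ i ∈ Finset.range (n + 1), u i * v (n - i) := by
        refine Finset.sum_le_sum fun n _ => ?_
        rw [PowerSeries.coeff_mul, Finset.Nat.sum_antidiagonal_eq_sum_range_succ_mk]
        refine (mul_le_mul_of_nonneg_right (norm_sum_le _ _) (by positivity)).trans ?_
        rw [Finset.sum_mul]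
        refine Finset.sum_le_sum fun i hi => ?_
        have hin : i + (n - i) = n := by
          have := Finset.mem_range.1 hi
          omega
        rw [norm_mul]
        conv_lhs => rw [← hin, pow_add]
        simp only [hu, hv, hin]
        exact le_of_eq (by ring)
    _ = ∑ i ∈ Finset.range N, ∑ j ∈ Finset.range (N - i), u i * v j :=
        Finset.sum_range_diag_flip N fun i j => u i * v j
    _ ≤ ∑ i ∈ Finset.range N, ∑ j ∈ Finset.range N, u i * v j := by
        refine Finset.sum_le_sum fun i _ => ?_
        refine Finset.sum_le_sum_of_subset_of_nonneg (Finset.range_mono (Nat.sub_le _ _)) ?_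
        intro j _ _
        positivity
    _ = truncNorm ρ N f * truncNorm ρ N g := by
        rw [truncNorm, truncNorm, Finset.sum_mul_sum]

omit hρ in
theorem truncNorm_succ_X_mul (N : ℕ) (f : PowerSeries ℂ) :
    truncNorm ρ (N + 1) (PowerSeries.X * f) = ρ * truncNorm ρ N f := by
  rw [truncNorm, Finset.sum_range_succ', truncNorm, Finset.mul_sum]
  simp only [PowerSeries.coeff_succ_X_mul, PowerSeries.coeff_zero_X_mul, norm_zero, zero_mul,
    add_zero]
  exact Finset.sum_congr rfl fun n _ => by ring

/-- Without constant terms, the coefficient of `X^N` in the product only involves coefficients of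
index below `N`. This gain of one index drives the induction in the implicit function theorem. -/
theorem truncNorm_succ_mul_le (N : ℕ) {f g : PowerSeries ℂ}
    (hf : PowerSeries.constantCoeff f = 0) (hg : PowerSeries.constantCoeff g = 0) :
    truncNorm ρ (N + 1) (f * g) ≤ truncNorm ρ N f * truncNorm ρ N g := by
  obtain ⟨f, rfl⟩ := PowerSeries.X_dvd_iff.2 hf
  obtain ⟨g, rfl⟩ := PowerSeries.X_dvd_iff.2 hg
  rw [mul_assoc, truncNorm_succ_X_mul]
  cases N with
  | zero => simp [truncNorm]
  | succ N =>
    rw [mul_left_comm, truncNorm_succ_X_mul, truncNorm_succ_X_mul, truncNorm_succ_X_mul]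
    calc ρ * (ρ * truncNorm ρ N (f * g))
        ≤ ρ * (ρ * (truncNorm ρ N f * truncNorm ρ N g)) := by
          gcongr
          exact truncNorm_mul_le hρ N f g
      _ = ρ * truncNorm ρ N f * (ρ * truncNorm ρ N g) := by ring

theorem truncNorm_pow_le {N : ℕ} {f : PowerSeries ℂ} (hf : truncNorm ρ N f ≤ 1) (j : ℕ) :
    truncNorm ρ N (f ^ j) ≤ 1 := by
  induction j with
  | zero =>
    cases N with
    | zero => simp [truncNorm]
    | succ N => simp [truncNorm, Finset.sum_range_succ', PowerSeries.coeff_one]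
  | succ j ih =>
    rw [pow_succ]
    exact (truncNorm_mul_le hρ N _ _).trans (mul_le_one₀ ih (truncNorm_nonneg hρ N f) hf)

theorem truncNorm_le_sum_norm (hρ1 : ρ ≤ 1) (N : ℕ) (f : PowerSeries ℂ) :
    truncNorm ρ N f ≤ ∑ n ∈ Finset.range N, ‖PowerSeries.coeff n f‖ :=
  Finset.sum_le_sum fun _ _ => mul_le_of_le_one_right (norm_nonneg _) (pow_le_one₀ hρ hρ1)

omit hρ in
theorem truncNorm_C_mul (N : ℕ) (a : ℂ) (f : PowerSeries ℂ) :
    truncNorm ρ N (PowerSeries.C a * f) = ‖a‖ * truncNorm ρ N f := by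
  simp only [truncNorm, PowerSeries.coeff_C_mul, norm_mul, mul_assoc, Finset.mul_sum]

omit hρ in
theorem truncNorm_neg (N : ℕ) (f : PowerSeries ℂ) :
    truncNorm ρ N (-f) = truncNorm ρ N f := by
  simp [truncNorm]

end truncNorm

/-! ### Formal implicit function theorem with uniform bounds. -/

/-- A quantitative implicit function theorem for formal power series: the coefficients of a formal
solution of a polynomial equation with invertible linear part are bounded geometrically, with
constants that depend only on bounds for the equation. -/
theorem exists_geometric_bound_of_sum_eq_zero (d : ℕ) {c E : ℝ} (hc : 0 < c) (hE : 0 ≤ E) :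
    ∃ ρ : ℝ, 0 < ρ ∧ ∀ (q : ℕ → PowerSeries ℂ) (y : PowerSeries ℂ),
      (∀ j < d + 2, ∀ N, ∑ n ∈ Finset.range N, ‖PowerSeries.coeff n (q j)‖ ≤ E) →
      c ≤ ‖PowerSeries.constantCoeff (q 1)‖ → PowerSeries.constantCoeff y = 0 →
      ∑ j ∈ Finset.range (d + 2), q j * y ^ j = 0 →
      ∀ n, ‖PowerSeries.coeff n y‖ * ρ ^ n ≤ 1 := by
  -- `σ` will bound every truncated norm of `y`. The terms of degree at least two then contribute at
  -- most `d * E * σ²`, half of the allowed `c * σ`.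
  obtain ⟨σ, hσ, hσ1, hσE⟩ : ∃ σ : ℝ, 0 < σ ∧ σ ≤ 1 ∧ d * E * σ ≤ c / 2 := by
    refine ⟨min 1 (c / (2 * (d * E + 1))), by positivity, min_le_left _ _, ?_⟩
    calc d * E * min 1 (c / (2 * (d * E + 1))) ≤ (d * E + 1) * (c / (2 * (d * E + 1))) := by
          gcongr
          · linarith
          · exact min_le_right _ _
      _ = c / 2 := by field_simp
  -- The other half of `c * σ` absorbs the two terms carrying a factor `X`, each at most `ρ * E`.
  obtain ⟨ρ, hρ, hρ1, hρE⟩ : ∃ ρ : ℝ, 0 < ρ ∧ ρ ≤ 1 ∧ 2 * E * ρ ≤ c * σ / 2 := by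
    refine ⟨min 1 (c * σ / 2 / (2 * E + 1)), by positivity, min_le_left _ _, ?_⟩
    calc 2 * E * min 1 (c * σ / 2 / (2 * E + 1)) ≤ (2 * E + 1) * (c * σ / 2 / (2 * E + 1)) := by
          gcongr
          · linarith
          · exact min_le_right _ _
      _ = c * σ / 2 := by field_simp
  refine ⟨ρ, hρ, fun q y hq hq1 hy hsum => ?_⟩
  have tail (f : PowerSeries ℂ) (N : ℕ) :
      ∑ n ∈ Finset.range N, ‖PowerSeries.coeff n (PowerSeries.mk fun n =>
        PowerSeries.coeff (n + 1) f)‖ ≤ ∑ n ∈ Finset.range (N + 1), ‖PowerSeries.coeff n f‖ := by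
    rw [Finset.sum_range_succ']
    simp
  have hE' (j N : ℕ) (hj : j < d + 2) : truncNorm ρ N (q j) ≤ E :=
    (truncNorm_le_sum_norm hρ.le hρ1 N _).trans (hq j hj N)
  have hE'' (j N : ℕ) (hj : j < d + 2) :
      truncNorm ρ N (PowerSeries.mk fun n => PowerSeries.coeff (n + 1) (q j)) ≤ E :=
    (truncNorm_le_sum_norm hρ.le hρ1 N _).trans ((tail _ N).trans (hq j hj _))
  set h : PowerSeries ℂ := ∑ j ∈ Finset.range d, q (j + 2) * y ^ j with hh
  have hsum' : q 0 + q 1 * y + y * (y * h) = 0 := by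
    rw [← hsum, Finset.sum_range_succ', Finset.sum_range_succ', hh, Finset.mul_sum,
      Finset.mul_sum]
    have (j : ℕ) : y * (y * (q (j + 2) * y ^ j)) = q (j + 1 + 1) * y ^ (j + 1 + 1) := by ring
    simp only [this]
    ring
  have hq0 : PowerSeries.constantCoeff (q 0) = 0 := by
    simpa [hy] using congrArg PowerSeries.constantCoeff hsum'
  have e0 := PowerSeries.eq_X_mul_shift_add_const (q 0)
  have e1 := PowerSeries.eq_X_mul_shift_add_const (q 1)
  set q0 := PowerSeries.mk fun n => PowerSeries.coeff (n + 1) (q 0)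
  set q1 := PowerSeries.mk fun n => PowerSeries.coeff (n + 1) (q 1)
  rw [hq0, map_zero, add_zero] at e0
  set a := PowerSeries.constantCoeff (q 1)
  -- Every term on the right has a factor `X` or is a product of two series without constant term,
  -- so its truncation at `N + 1` is controlled by that of `y` at `N`.
  have key : PowerSeries.C a * y =
      -(PowerSeries.X * q0 + PowerSeries.X * (q1 * y) + y * (y * h)) := by
    rw [e0, e1] at hsum'
    linear_combination hsum'
  have bound (N : ℕ) : truncNorm ρ N y ≤ σ := by
    induction N with
    | zero => simpa [truncNorm] using hσ.le
    | succ N ih =>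
      have hhN : truncNorm ρ N h ≤ d * E := by
        refine (truncNorm_sum_le hρ.le _ N _).trans ?_
        have : ∀ j ∈ Finset.range d, truncNorm ρ N (q (j + 2) * y ^ j) ≤ E := fun j hj =>
          (truncNorm_mul_le hρ.le N _ _).trans <| by
            have hj' := Finset.mem_range.1 hj
            calc _ ≤ E * 1 := mul_le_mul (hE' _ _ (by omega)) (truncNorm_pow_le hρ.le (ih.trans hσ1) j)
                  (truncNorm_nonneg hρ.le _ _) hE
              _ = E := mul_one E
        simpa using Finset.sum_le_sum this
      have h0 := truncNorm_nonneg hρ.le N y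
      have b0 : truncNorm ρ (N + 1) (PowerSeries.X * q0) ≤ ρ * E := by
        rw [truncNorm_succ_X_mul]
        exact mul_le_mul_of_nonneg_left (hE'' 0 N (by omega)) hρ.le
      have b1 : truncNorm ρ (N + 1) (PowerSeries.X * (q1 * y)) ≤ ρ * E := by
        rw [truncNorm_succ_X_mul]
        refine mul_le_mul_of_nonneg_left ((truncNorm_mul_le hρ.le N _ _).trans ?_) hρ.le
        exact (mul_le_mul (hE'' 1 N (by omega)) (ih.trans hσ1) h0 hE).trans_eq (mul_one E)
      have b2 : truncNorm ρ (N + 1) (y * (y * h)) ≤ σ * (c / 2) := by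
        refine (truncNorm_succ_mul_le hρ.le N hy (by simp [hy])).trans ?_
        refine mul_le_mul ih ?_ (truncNorm_nonneg hρ.le _ _) hσ.le
        refine (truncNorm_mul_le hρ.le N _ _).trans ?_
        calc _ ≤ σ * (d * E) := mul_le_mul ih hhN (truncNorm_nonneg hρ.le _ _) hσ.le
          _ ≤ c / 2 := by rwa [mul_comm]
      have total : ‖a‖ * truncNorm ρ (N + 1) y ≤ c * σ := by
        rw [← truncNorm_C_mul, key, truncNorm_neg]
        have t1 := truncNorm_add_le hρ.le (N + 1) (PowerSeries.X * q0 + PowerSeries.X * (q1 * y))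
          (y * (y * h))
        have t2 := truncNorm_add_le hρ.le (N + 1) (PowerSeries.X * q0) (PowerSeries.X * (q1 * y))
        linarith
      have := mul_le_mul_of_nonneg_right hq1 (truncNorm_nonneg hρ.le (N + 1) y)
      exact le_of_mul_le_mul_left (this.trans total) hc
  intro n
  refine le_trans ?_ ((bound (n + 1)).trans hσ1)
  exact Finset.single_le_sum (f := fun n => ‖PowerSeries.coeff n y‖ * ρ ^ n)
    (fun _ _ => by positivity) (Finset.self_mem_range_succ n)

/-! ### Convergence from coefficient bounds, and positivity of the radius. -/

/-- The linear factor costs nothing on the open disc; it accommodates the `N + 1` Cauchy estimates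
that are summed in `norm_coeff_mul_add_pow_le`. -/
theorem mem_relevantRadii_of_norm_le {F : PowerSeries ℂ} {ρ M : ℝ} (hρ : 0 < ρ)
    (h : ∀ n : ℕ, ‖PowerSeries.coeff n F‖ * ρ ^ n ≤ M * (n + 1)) : ρ ∈ relevantRadii F := by
  refine ⟨hρ, fun z hz => ?_⟩
  rw [mem_ball_zero_iff] at hz
  set t := ‖z‖ / ρ with ht
  have ht1 : ‖t‖ < 1 := by
    rw [Real.norm_of_nonneg (by positivity), ht, div_lt_one hρ]
    exact hz
  have hs : Summable fun n : ℕ => M * ((n : ℝ) ^ 1 * t ^ n + t ^ n) :=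
    ((summable_pow_mul_geometric_of_norm_lt_one 1 ht1).add
      (summable_geometric_of_norm_lt_one ht1)).mul_left M
  refine Summable.of_norm_bounded hs fun n => ?_
  rw [norm_mul, norm_pow]
  have hz' : ‖z‖ = ρ * t := by rw [ht]; field_simp
  calc ‖PowerSeries.coeff n F‖ * ‖z‖ ^ n = ‖PowerSeries.coeff n F‖ * ρ ^ n * t ^ n := by
        rw [hz', mul_pow, mul_assoc]
    _ ≤ M * (n + 1) * t ^ n := mul_le_mul_of_nonneg_right (h n) (by positivity)
    _ = M * ((n : ℝ) ^ 1 * t ^ n + t ^ n) := by ring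

theorem relevantRadii_shift (F : PowerSeries ℂ) (N : ℕ) :
    relevantRadii (PowerSeries.mk fun n => PowerSeries.coeff (n + N) F) = relevantRadii F := by
  have key (z : ℂ) : (Summable fun n : ℕ => PowerSeries.coeff n
      (PowerSeries.mk fun n => PowerSeries.coeff (n + N) F) * z ^ n) ↔
      Summable fun n : ℕ => PowerSeries.coeff n F * z ^ n := by
    rcases eq_or_ne z 0 with rfl | hz
    · have (G : PowerSeries ℂ) : Summable fun n : ℕ => PowerSeries.coeff n G * (0 : ℂ) ^ n :=
        summable_of_ne_finset_zero (s := {0}) fun n hn => by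
          simp [zero_pow (Finset.notMem_singleton.1 hn)]
      exact iff_of_true (this _) (this _)
    · rw [← summable_nat_add_iff N (f := fun n => PowerSeries.coeff n F * z ^ n),
        ← summable_mul_right_iff (pow_ne_zero N hz)]
      simp only [PowerSeries.coeff_mk, pow_add, mul_assoc]
  ext r
  simp only [relevantRadii, key]

theorem eval₂_taylor {R S : Type*} [CommSemiring R] [CommSemiring S] (φ : R →+* S) (P : R[X])
    (r : R) (t : S) : (P.taylor r).eval₂ φ t = P.eval₂ φ (t + φ r) := by
  simp [Polynomial.taylor_apply, Polynomial.eval₂_comp]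

theorem exists_sum_norm_coeff_le {f : PowerSeries ℂ} {K : ℕ}
    (hf : ∀ n, K ≤ n → PowerSeries.coeff n f = 0) (N : ℕ) :
    ∑ n ∈ Finset.range N, ‖PowerSeries.coeff n f‖ ≤
      ∑ n ∈ Finset.range K, ‖PowerSeries.coeff n f‖ := by
  calc ∑ n ∈ Finset.range N, ‖PowerSeries.coeff n f‖
      ≤ ∑ n ∈ Finset.range (K + N), ‖PowerSeries.coeff n f‖ :=
        Finset.sum_le_sum_of_subset_of_nonneg (Finset.range_mono (by omega)) fun _ _ _ =>
          norm_nonneg _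
    _ = ∑ n ∈ Finset.range K, ‖PowerSeries.coeff n f‖ := by
        rw [Finset.sum_range_add]
        simp [hf]

/-- An algebraic power series has a positive radius of convergence. -/
theorem exists_mem_relevantRadii {P : ℂ[X][X]} {F : PowerSeries ℂ}
    (hP : P.eval₂ Polynomial.coeToPowerSeries.ringHom F = 0)
    (hP' : P.derivative.eval₂ Polynomial.coeToPowerSeries.ringHom F ≠ 0) :
    ∃ ρ, ρ ∈ relevantRadii F := by
  set φ : ℂ[X] →+* PowerSeries ℂ := Polynomial.coeToPowerSeries.ringHom with hφ
  have hcoe (p : ℂ[X]) (n : ℕ) : PowerSeries.coeff n (φ p) = p.coeff n := by simp [hφ]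
  set β := P.derivative.eval₂ φ F with hβ
  -- With `e = ord P_T(F)`, write `F = S + X^e * y` with `S` the truncation and `y(0) = 0`.
  -- Expanding `P` at `S`, all terms become divisible by `X^(2e)`, and the linear coefficient
  -- becomes a unit after division.
  set e := β.order.toNat with he
  set S := PowerSeries.trunc (e + 1) F with hS
  set w := PowerSeries.mk fun i => PowerSeries.coeff (i + (e + 1)) F with hw
  have hF : F = PowerSeries.X ^ e * (PowerSeries.X * w) + φ S := by
    conv_lhs => rw [PowerSeries.eq_X_pow_mul_shift_add_trunc (e + 1) F]
    rw [pow_succ, mul_assoc]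
    rfl
  set y := PowerSeries.X * w with hy
  set p : ℕ → ℂ[X] := fun j => (P.taylor S).coeff j with hp
  have hsum : ∑ j ∈ Finset.range (P.natDegree + 2), φ (p j) * (PowerSeries.X ^ e * y) ^ j = 0 := by
    rw [← hP, hF, ← eval₂_taylor, Polynomial.eval₂_eq_sum_range' φ (n := P.natDegree + 2)]
    rw [Polynomial.natDegree_taylor]
    omega
  have hp1 : φ (p 1) = P.derivative.eval₂ φ (φ S) := by
    rw [hp]
    simp [Polynomial.taylor_coeff_one, Polynomial.eval₂_at_apply]
  -- `F` and `S` agree modulo `X^(e+1)`, so `P_T(S)` has the same order `e` as `P_T(F)`.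
  obtain ⟨v, hv⟩ : PowerSeries.X ^ (e + 1) ∣ β - φ (p 1) := by
    rw [hp1, hβ, Polynomial.eval₂_eq_eval_map, Polynomial.eval₂_eq_eval_map]
    refine dvd_trans ?_ (Polynomial.sub_dvd_eval_sub F (φ S) _)
    rw [hF, add_sub_cancel_right, hy, pow_succ]
    exact mul_dvd_mul_left _ (dvd_mul_right _ _)
  obtain ⟨b, hb⟩ : PowerSeries.X ^ e ∣ β := PowerSeries.X_pow_order_dvd
  have hb0 : PowerSeries.constantCoeff b ≠ 0 := by
    have := PowerSeries.coeff_order hP'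
    rw [← he, hb] at this
    simpa [PowerSeries.coeff_X_pow_mul'] using this
  set u := b - PowerSeries.X * v with hu
  have hu1 : φ (p 1) = PowerSeries.X ^ e * u := by
    rw [hu, mul_sub, ← hb]
    linear_combination -hv
  have hu0 : PowerSeries.constantCoeff u ≠ 0 := by simpa [hu] using hb0
  set h := ∑ j ∈ Finset.range P.natDegree, φ (p (j + 2)) * (PowerSeries.X ^ e) ^ j * y ^ (j + 2)
    with hh
  set s := -(u * y + h) with hs
  have hs0 : φ (p 0) = PowerSeries.X ^ (2 * e) * s := by
    rw [Finset.sum_range_succ', Finset.sum_range_succ'] at hsum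
    have : ∑ j ∈ Finset.range P.natDegree,
        φ (p (j + 1 + 1)) * (PowerSeries.X ^ e * y) ^ (j + 1 + 1) =
        PowerSeries.X ^ (2 * e) * h := by
      rw [hh, Finset.mul_sum]
      exact Finset.sum_congr rfl fun j _ => by ring
    rw [this, zero_add, hu1] at hsum
    rw [hs]
    linear_combination hsum
  let q : ℕ → PowerSeries ℂ := fun j => match j with
    | 0 => s
    | 1 => u
    | j + 2 => φ (p (j + 2)) * (PowerSeries.X ^ e) ^ j
  -- The divided coefficients are still polynomials, so the sums of their coefficient norms are
  -- finite.
  have hq (j : ℕ) : ∃ K, ∀ n, K ≤ n → PowerSeries.coeff n (q j) = 0 := by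
    have vanish (f : PowerSeries ℂ) (r : ℂ[X]) (m : ℕ) (hf : φ r = PowerSeries.X ^ m * f) :
        ∃ K, ∀ n, K ≤ n → PowerSeries.coeff n f = 0 := by
      refine ⟨r.natDegree + 1, fun n hn => ?_⟩
      have : PowerSeries.coeff (n + m) (φ r) = PowerSeries.coeff n f := by
        rw [hf, PowerSeries.coeff_X_pow_mul]
      rw [← this, hcoe]
      exact Polynomial.coeff_eq_zero_of_natDegree_lt (by omega)
    match j with
    | 0 => exact vanish _ _ _ hs0
    | 1 => exact vanish _ _ _ hu1
    | j + 2 =>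
      refine vanish _ (p (j + 2) * (Polynomial.X ^ e) ^ j) 0 ?_
      simp [q, hφ]
  choose K hK using hq
  set E : ℕ → ℝ := fun j => ∑ n ∈ Finset.range (K j), ‖PowerSeries.coeff n (q j)‖ with hE
  have hE0 (j : ℕ) : 0 ≤ E j := Finset.sum_nonneg fun _ _ => norm_nonneg _
  obtain ⟨ρ, hρ, key⟩ := exists_geometric_bound_of_sum_eq_zero P.natDegree (norm_pos_iff.2 hu0)
    (Finset.sum_nonneg fun j (_ : j ∈ Finset.range (P.natDegree + 2)) => hE0 j)
  have hbound := key q y (fun j hj N => (exists_sum_norm_coeff_le (hK j) N).trans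
    (Finset.single_le_sum (f := E) (fun j _ => hE0 j) (Finset.mem_range.2 hj))) le_rfl
    (by simp [hy]) (by
      rw [Finset.sum_range_succ', Finset.sum_range_succ']
      simp only [q, zero_add, pow_one, pow_zero, mul_one]
      rw [← hh, hs]
      ring)
  refine ⟨ρ, ?_⟩
  rw [← relevantRadii_shift F (e + 1)]
  refine mem_relevantRadii_of_norm_le (M := 1 / ρ) hρ fun n => ?_
  have := hbound (n + 1)
  rw [hy, PowerSeries.coeff_succ_X_mul, pow_succ, ← mul_assoc, ← le_div_iff₀ hρ] at this
  exact this.trans (le_mul_of_one_le_right (by positivity) (by simp))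

/-! ### Taylor expansion as a ring homomorphism, and holomorphic realizations of power series. -/

/-- The Taylor series at `z` of a complex function. -/
noncomputable def taylorSeriesAt (f : ℂ → ℂ) (z : ℂ) : PowerSeries ℂ :=
  PowerSeries.mk fun n => iteratedDeriv n f z / n.factorial

/-- The ring of functions analytic at `z`. -/
def analyticSubring (z : ℂ) : Subring (ℂ → ℂ) where
  carrier := {f | AnalyticAt ℂ f z}
  mul_mem' hf hg := AnalyticAt.mul hf hg
  one_mem' := analyticAt_const
  add_mem' hf hg := AnalyticAt.add hf hg
  zero_mem' := analyticAt_const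
  neg_mem' hf := AnalyticAt.neg hf

theorem taylorSeriesAt_const (a z : ℂ) : taylorSeriesAt (fun _ => a) z = PowerSeries.C a := by
  ext n
  rw [taylorSeriesAt, PowerSeries.coeff_mk, iteratedDeriv_const, PowerSeries.coeff_C]
  split_ifs with h <;> simp [h]

/-- Taylor expansion at `z` as a ring homomorphism. -/
noncomputable def taylorHom (z : ℂ) : analyticSubring z →+* PowerSeries ℂ where
  toFun f := taylorSeriesAt f.1 z
  map_one' := taylorSeriesAt_const 1 z
  map_zero' := (taylorSeriesAt_const 0 z).trans (map_zero _)
  map_add' f g := by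
    ext n
    simp only [taylorSeriesAt, PowerSeries.coeff_mk, map_add, Subring.coe_add]
    rw [iteratedDeriv_add (AnalyticAt.contDiffAt f.2) (AnalyticAt.contDiffAt g.2), add_div]
  map_mul' f g := by
    ext n
    simp only [taylorSeriesAt, PowerSeries.coeff_mk, PowerSeries.coeff_mul, Subring.coe_mul,
      iteratedDeriv_mul (AnalyticAt.contDiffAt f.2) (AnalyticAt.contDiffAt g.2),
      Finset.Nat.sum_antidiagonal_eq_sum_range_succ_mk, Finset.sum_div]
    refine Finset.sum_congr rfl fun i hi => ?_
    rw [Nat.cast_choose _ (by grind)]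
    field_simp [Nat.factorial_ne_zero]

/-- Polynomials as analytic functions. -/
noncomputable def polynomialFunction (z : ℂ) : ℂ[X] →+* analyticSubring z where
  toFun p := ⟨fun w => p.eval w, AnalyticOnNhd.eval_polynomial p z (Set.mem_univ z)⟩
  map_one' := by ext; simp
  map_zero' := by ext; simp
  map_add' p q := by ext; simp
  map_mul' p q := by ext; simp

/-- The Taylor expansion at `z` of a polynomial, as a power series. -/
noncomputable def polynomialTaylor (z : ℂ) : ℂ[X] →+* PowerSeries ℂ :=
  Polynomial.coeToPowerSeries.ringHom.comp (Polynomial.taylorAlgHom z : ℂ[X] →+* ℂ[X])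

theorem taylorHom_comp_polynomialFunction (z : ℂ) :
    (taylorHom z).comp (polynomialFunction z) = polynomialTaylor z := by
  refine Polynomial.ringHom_ext (fun a => ?_) ?_
  · have : polynomialTaylor z (Polynomial.C a) = PowerSeries.C a := by simp [polynomialTaylor]
    rw [this, ← taylorSeriesAt_const a z]
    simp only [RingHom.comp_apply, taylorHom, polynomialFunction, RingHom.coe_mk, MonoidHom.coe_mk,
      OneHom.coe_mk, Polynomial.eval_C]
    rfl
  · ext n
    have : polynomialTaylor z Polynomial.X = PowerSeries.X + PowerSeries.C z := by
      simp [polynomialTaylor]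
    rw [this]
    rcases n with _ | _ | n
    · simp [taylorHom, polynomialFunction, taylorSeriesAt]
    · simp [taylorHom, polynomialFunction, taylorSeriesAt]
    · simp [taylorHom, polynomialFunction, taylorSeriesAt, PowerSeries.coeff_X,
        iteratedDeriv_succ']

theorem evalEval_eq_eval₂_polynomialFunction (P : ℂ[X][X]) {f : ℂ → ℂ} {z : ℂ}
    (hf : AnalyticAt ℂ f z) : (fun w => P.evalEval w (f w)) =
      (P.eval₂ (polynomialFunction z) (⟨f, hf⟩ : analyticSubring z)).1 := by
  ext w
  rw [← Polynomial.eval₂_evalRingHom]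
  let ev : analyticSubring z →+* ℂ :=
    (Pi.evalRingHom (fun _ : ℂ => ℂ) w).comp (Subring.subtype _)
  change _ = ev _
  rw [Polynomial.hom_eval₂]
  congr 1

theorem taylorSeriesAt_evalEval (P : ℂ[X][X]) {f : ℂ → ℂ} {z : ℂ} (hf : AnalyticAt ℂ f z) :
    taylorSeriesAt (fun w => P.evalEval w (f w)) z =
      P.eval₂ (polynomialTaylor z) (taylorSeriesAt f z) := by
  have h2 := Polynomial.hom_eval₂ P (polynomialFunction z) (taylorHom z)
    (⟨f, hf⟩ : analyticSubring z)
  rw [taylorHom_comp_polynomialFunction] at h2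
  rw [evalEval_eq_eval₂_polynomialFunction P hf]
  exact h2

theorem taylorSeriesAt_congr {f g : ℂ → ℂ} {z : ℂ} (h : f =ᶠ[nhds z] g) :
    taylorSeriesAt f z = taylorSeriesAt g z := by
  ext n
  simp [taylorSeriesAt, h.iteratedDeriv_eq n]

theorem polynomialTaylor_zero : polynomialTaylor 0 = Polynomial.coeToPowerSeries.ringHom := by
  refine Polynomial.ringHom_ext (fun a => ?_) ?_ <;> simp [polynomialTaylor]

/-- Taylor expansion is multiplicative, so `w ↦ P(w, f w)` has zero Taylor series at `0`; being
holomorphic on the disc, it is the sum of that series. -/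
theorem evalEval_eq_zero_of_eval₂_taylorSeriesAt {P : ℂ[X][X]} {f : ℂ → ℂ} {R : ℝ} (hR : 0 < R)
    (hf : DifferentiableOn ℂ f (Metric.ball 0 R))
    (hP : P.eval₂ Polynomial.coeToPowerSeries.ringHom (taylorSeriesAt f 0) = 0)
    {w : ℂ} (hw : w ∈ Metric.ball 0 R) : P.evalEval w (f w) = 0 := by
  have han (z : ℂ) (hz : z ∈ Metric.ball (0 : ℂ) R) : AnalyticAt ℂ f z :=
    hf.analyticAt (Metric.isOpen_ball.mem_nhds hz)
  have hg : DifferentiableOn ℂ (fun w => P.evalEval w (f w)) (Metric.ball 0 R) := by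
    intro z hz
    rw [evalEval_eq_eval₂_polynomialFunction P (han z hz)]
    exact (P.eval₂ (polynomialFunction z)
      (⟨f, han z hz⟩ : analyticSubring z)).2.differentiableAt.differentiableWithinAt
  rw [← Complex.taylorSeries_eq_on_ball' hw hg]
  rw [← polynomialTaylor_zero, ← taylorSeriesAt_evalEval P (han 0 (Metric.mem_ball_self hR))] at hP
  have (n : ℕ) : (n.factorial : ℂ)⁻¹ * iteratedDeriv n (fun w => P.evalEval w (f w)) 0 = 0 := by
    have := congrArg (PowerSeries.coeff n) hP
    rwa [taylorSeriesAt, PowerSeries.coeff_mk, map_zero, div_eq_inv_mul] at this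
  simp [this]

theorem exists_differentiableOn_of_mem_relevantRadii {F : PowerSeries ℂ} {R : ℝ}
    (hR : R ∈ relevantRadii F) :
    ∃ f : ℂ → ℂ, DifferentiableOn ℂ f (Metric.ball 0 R) ∧ taylorSeriesAt f 0 = F := by
  set p := FormalMultilinearSeries.ofScalars ℂ fun n => PowerSeries.coeff n F with hp
  have hrad : ENNReal.ofReal R ≤ p.radius := by
    refine ENNReal.le_of_forall_nnreal_lt fun r hr => ?_
    have hr' : (r : ℝ) < R := by
      rwa [← ENNReal.ofReal_coe_nnreal, ENNReal.ofReal_lt_ofReal_iff hR.1] at hr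
    have hs := hR.2 (r : ℂ) (by simpa using hr')
    refine p.le_radius_of_tendsto (l := 0) ?_
    have := hs.tendsto_atTop_zero.norm
    simpa [hp, FormalMultilinearSeries.ofScalars_norm] using this
  have hps := p.hasFPowerSeriesOnBall ((ENNReal.ofReal_pos.2 hR.1).trans_le hrad)
  refine ⟨p.sum, ?_, ?_⟩
  · refine hps.differentiableOn.mono ?_
    rw [← Metric.eball_ofReal]
    exact Metric.eball_subset_eball hrad
  · ext n
    have := hps.factorial_smul 1 n
    rw [iteratedFDeriv_apply_eq_iteratedDeriv_mul_prod, Finset.prod_const_one, one_smul] at this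
    rw [taylorSeriesAt, PowerSeries.coeff_mk, ← this, hp, FormalMultilinearSeries.ofScalars_apply_eq]
    simp [Nat.factorial_ne_zero]

/-! ### Uniform bounds for bivariate polynomials on compact sets. -/

theorem continuous_evalEval (P : ℂ[X][X]) :
    Continuous fun x : ℂ × ℂ => P.evalEval x.1 x.2 := by
  induction P using Polynomial.induction_on' with
  | add P Q hP hQ =>
    simp only [Polynomial.evalEval_add]
    exact hP.add hQ
  | monomial n p =>
    simp only [Polynomial.evalEval, Polynomial.eval_monomial, ← Polynomial.C_pow,
      Polynomial.eval_mul, Polynomial.eval_C]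
    exact (p.continuous.comp continuous_fst).mul (continuous_snd.pow n)

/-- The expansion of a bivariate polynomial around the point `(z, w)`. -/
noncomputable def bivariateTaylor (P : ℂ[X][X]) (x : ℂ × ℂ) : ℂ[X][X] :=
  (P.map (Polynomial.taylorAlgHom x.1 : ℂ[X] →+* ℂ[X])).taylor (Polynomial.C x.2)

/-- The degree bound `K` is independent of the expansion point, so a finite sum of continuous
functions bounds the expansion uniformly on a compact set. -/
theorem exists_continuous_coeff_bivariateTaylor (P : ℂ[X][X]) : ∃ K : ℕ, ∀ j i : ℕ,
    (Continuous fun x : ℂ × ℂ => ((bivariateTaylor P x).coeff j).coeff i) ∧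
      (K ≤ i → ∀ x, ((bivariateTaylor P x).coeff j).coeff i = 0) := by
  induction P using Polynomial.induction_on' with
  | add P Q hP hQ =>
    obtain ⟨K, hK⟩ := hP
    obtain ⟨L, hL⟩ := hQ
    have hadd (x : ℂ × ℂ) (j i : ℕ) : ((bivariateTaylor (P + Q) x).coeff j).coeff i =
        ((bivariateTaylor P x).coeff j).coeff i + ((bivariateTaylor Q x).coeff j).coeff i := by
      simp [bivariateTaylor]
    refine ⟨max K L, fun j i => ⟨?_, fun hi x => ?_⟩⟩
    · simp only [hadd]
      exact (hK j i).1.add (hL j i).1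
    · rw [hadd, (hK j i).2 (le_of_max_le_left hi), (hL j i).2 (le_of_max_le_right hi), add_zero]
  | monomial n p =>
    have hmon (x : ℂ × ℂ) (j i : ℕ) : ((bivariateTaylor (Polynomial.monomial n p) x).coeff j).coeff i
        = (Polynomial.hasseDeriv i p).eval x.1 * (x.2 ^ (n - j) * (n.choose j : ℂ)) := by
      rw [bivariateTaylor, Polynomial.map_monomial, Polynomial.taylor_monomial,
        Polynomial.coeff_C_mul, Polynomial.coeff_X_add_C_pow, ← Polynomial.C_pow,
        ← Polynomial.C_eq_natCast, ← Polynomial.C_mul, Polynomial.coeff_mul_C]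
      rw [← Polynomial.taylor_coeff]
      rfl
    refine ⟨p.natDegree + 1, fun j i => ⟨?_, fun hi x => ?_⟩⟩
    · simp only [hmon]
      fun_prop
    · rw [hmon, Polynomial.hasseDeriv_eq_zero_of_lt_natDegree _ _ (by omega)]
      simp

theorem natDegree_bivariateTaylor_le (P : ℂ[X][X]) (x : ℂ × ℂ) :
    (bivariateTaylor P x).natDegree ≤ P.natDegree := by
  rw [bivariateTaylor, Polynomial.natDegree_taylor]
  exact Polynomial.natDegree_map_le

theorem eval₂_bivariateTaylor (P : ℂ[X][X]) (x : ℂ × ℂ) (t : PowerSeries ℂ) :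
    (bivariateTaylor P x).eval₂ Polynomial.coeToPowerSeries.ringHom t =
      P.eval₂ (polynomialTaylor x.1) (t + PowerSeries.C x.2) := by
  rw [bivariateTaylor, eval₂_taylor, Polynomial.eval₂_map]
  simp [polynomialTaylor]

theorem coeff_zero_coeff_one_bivariateTaylor (P : ℂ[X][X]) (x : ℂ × ℂ) :
    ((bivariateTaylor P x).coeff 1).coeff 0 = P.derivative.evalEval x.1 x.2 := by
  rw [bivariateTaylor, Polynomial.taylor_coeff_one, Polynomial.derivative_map,
    ← Polynomial.coe_evalRingHom, Polynomial.coeff_zero_eq_eval_zero, Polynomial.evalEval,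
    Polynomial.coe_evalRingHom]
  have : Polynomial.C x.2 = (Polynomial.taylorAlgHom x.1 : ℂ[X] →+* ℂ[X]) (Polynomial.C x.2) := by
    simp
  rw [this, Polynomial.eval_map_apply]
  simp [Polynomial.taylor_eval]

/-- Cauchy's root bound is dominated by a continuous function of `z` as long as the leading
coefficient does not vanish. -/
theorem exists_norm_root_le {P : ℂ[X][X]} {A : Set ℂ} (hA : IsCompact A)
    (hP : ∀ z ∈ A, P.leadingCoeff.eval z ≠ 0) :
    ∃ W : ℝ, ∀ z ∈ A, ∀ w, P.evalEval z w = 0 → ‖w‖ ≤ W := by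
  have hcont : ContinuousOn (fun z => (∑ j ∈ Finset.range P.natDegree, ‖(P.coeff j).eval z‖) /
      ‖P.leadingCoeff.eval z‖ + 1) A := by
    refine ContinuousOn.add (ContinuousOn.div ?_ ?_ ?_) continuousOn_const
    · fun_prop
    · fun_prop
    · exact fun z hz => norm_ne_zero_iff.2 (hP z hz)
  obtain ⟨W, hW⟩ := hA.exists_bound_of_continuousOn hcont
  refine ⟨W, fun z hz w hw => ?_⟩
  set Q := P.map (Polynomial.evalRingHom z) with hQ
  have hlc : (Polynomial.evalRingHom z) P.leadingCoeff ≠ 0 := hP z hz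
  have hdeg : Q.natDegree = P.natDegree :=
    Polynomial.natDegree_map_of_leadingCoeff_ne_zero _ hlc
  have hlead : Q.leadingCoeff = P.leadingCoeff.eval z :=
    Polynomial.leadingCoeff_map_of_leadingCoeff_ne_zero _ hlc
  have hQ0 : Q ≠ 0 := by
    rw [← Polynomial.leadingCoeff_ne_zero, hlead]
    exact hP z hz
  have hroot : Q.IsRoot w := by
    rw [Polynomial.IsRoot, hQ, Polynomial.eval_map, Polynomial.eval₂_evalRingHom, hw]
  refine le_trans (b := (Q.cauchyBound : ℝ))
    (by exact_mod_cast (Polynomial.IsRoot.norm_lt_cauchyBound hQ0 hroot).le) ?_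
  refine le_trans ?_ ((le_abs_self _).trans (hW z hz))
  rw [Polynomial.cauchyBound, hdeg, hlead]
  push_cast
  gcongr
  have hsup : (Finset.range P.natDegree).sup (fun j => ‖Q.coeff j‖₊) ≤
      ∑ j ∈ Finset.range P.natDegree, ‖(P.coeff j).eval z‖₊ := by
    refine Finset.sup_le fun j hj => ?_
    rw [hQ, Polynomial.coeff_map, Polynomial.coe_evalRingHom]
    exact Finset.single_le_sum (f := fun j => ‖(P.coeff j).eval z‖₊) (fun _ _ => zero_le) hj
  have := NNReal.coe_le_coe.2 hsup
  simpa only [NNReal.coe_sum, coe_nnnorm] using this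

theorem exists_annulus_eval_ne_zero {G : ℂ[X]} {R : ℝ} (hR : 0 < R)
    (hG : ∀ z : ℂ, ‖z‖ = R → G.eval z ≠ 0) :
    ∃ r, 0 < r ∧ r < R ∧ ∀ z : ℂ, r ≤ ‖z‖ → ‖z‖ ≤ R → G.eval z ≠ 0 := by
  have hG0 : G ≠ 0 := by
    rintro rfl
    exact hG R (by simp [hR.le]) (by simp)
  set S := G.roots.toFinset.image norm with hS
  have hRS : R ∉ S := by
    intro h
    obtain ⟨z, hz, rfl⟩ := Finset.mem_image.1 h
    exact hG z rfl (Polynomial.isRoot_of_mem_roots (Multiset.mem_toFinset.1 hz))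
  obtain ⟨ε, hε, hball⟩ := Metric.isOpen_iff.1 S.finite_toSet.isClosed.isOpen_compl R hRS
  -- The roots have finitely many moduli, none within `ε` of `R`; `R / 2` only keeps the inner
  -- radius positive.
  refine ⟨max (R / 2) (R - ε / 2), by positivity, max_lt (by linarith) (by linarith),
    fun z h1 h2 h => ?_⟩
  have hz : ‖z‖ ∈ S := Finset.mem_image.2 ⟨z, by simpa [hG0] using h, rfl⟩
  refine hball ?_ hz
  rw [Metric.mem_ball, Real.dist_eq, abs_lt]
  constructor <;> linarith [(le_max_right _ _).trans h1]

/-! ### Enlarging the disc of convergence. -/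

/-- Cauchy's estimate for the `m`-th derivative of `f^(n) / n!` on `|z| = r` gives `(m+n choose m) *
|a_(m+n)| * r^m * ρ^n ≤ M`. Summing over `m + n = N` yields `(r + ρ)^N` by the binomial theorem. -/
theorem norm_coeff_mul_add_pow_le {f : ℂ → ℂ} {R r ρ M : ℝ} (hr : 0 < r) (hrR : r < R)
    (hρ : 0 < ρ) (hf : DifferentiableOn ℂ f (Metric.ball 0 R))
    (h : ∀ z : ℂ, ‖z‖ = r → ∀ n, ‖PowerSeries.coeff n (taylorSeriesAt f z)‖ * ρ ^ n ≤ M)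
    (N : ℕ) : ‖PowerSeries.coeff N (taylorSeriesAt f 0)‖ * (r + ρ) ^ N ≤ M * (N + 1) := by
  have han : AnalyticOnNhd ℂ f (Metric.ball 0 R) := hf.analyticOnNhd Metric.isOpen_ball
  have hfac (n : ℕ) : (0 : ℝ) < n.factorial := by exact_mod_cast n.factorial_pos
  have hterm (m n : ℕ) : ‖PowerSeries.coeff (m + n) (taylorSeriesAt f 0)‖ *
      (r ^ m * ρ ^ n * ((m + n).choose m)) ≤ M := by
    have hd : DiffContOnCl ℂ (iteratedDeriv n f) (Metric.ball 0 r) := by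
      rw [iteratedDeriv_eq_iterate]
      exact (han.iterated_deriv n).differentiableOn.diffContOnCl_ball
        (Metric.closedBall_subset_ball hrR)
    have hC (z : ℂ) (hz : z ∈ Metric.sphere (0 : ℂ) r) :
        ‖iteratedDeriv n f z‖ ≤ n.factorial * M / ρ ^ n := by
      have := h z (by simpa using hz) n
      rw [taylorSeriesAt, PowerSeries.coeff_mk, norm_div, Complex.norm_natCast,
        div_mul_eq_mul_div, div_le_iff₀ (hfac n)] at this
      rw [le_div_iff₀ (by positivity)]
      linarith
    have := Complex.norm_iteratedDeriv_le_of_forall_mem_sphere_norm_le m hr hd hC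
    have hcomp : iteratedDeriv m (iteratedDeriv n f) = iteratedDeriv (m + n) f := by
      simp only [iteratedDeriv_eq_iterate, Function.iterate_add_apply]
    rw [hcomp, le_div_iff₀ (by positivity), mul_div_assoc', le_div_iff₀ (by positivity)] at this
    rw [taylorSeriesAt, PowerSeries.coeff_mk, norm_div, Complex.norm_natCast,
      Nat.cast_choose ℝ (Nat.le_add_right m n), Nat.add_sub_cancel_left]
    have h1 := hfac m
    have h2 := hfac n
    have h3 := hfac (m + n)
    field_simp
    linarith
  rw [add_pow, Finset.mul_sum]
  calc _ ≤ ∑ m ∈ Finset.range (N + 1), M := by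
        refine Finset.sum_le_sum fun m hm => ?_
        have := hterm m (N - m)
        rwa [Nat.add_sub_of_le (Nat.lt_succ_iff.1 (Finset.mem_range.1 hm))] at this
    _ = M * (N + 1) := by simp [mul_comm]

/-- If the polynomial `D`, a multiple of `P_T(X, F)` in `ℂ[X][F]`, and the leading coefficient
of `P` have no zeros on the circle `|z| = R`, then the algebraic power series `F` converges on a
disc of radius greater than `R`. -/
theorem exists_mem_relevantRadii_gt {P B : ℂ[X][X]} {D : ℂ[X]} {F : PowerSeries ℂ} {R : ℝ}
    (hR : R ∈ relevantRadii F) (hP : P.eval₂ Polynomial.coeToPowerSeries.ringHom F = 0)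
    (hB : B.eval₂ Polynomial.coeToPowerSeries.ringHom F *
      P.derivative.eval₂ Polynomial.coeToPowerSeries.ringHom F = D)
    (hRD : ∀ z : ℂ, ‖z‖ = R → (P.leadingCoeff * D).eval z ≠ 0) :
    ∃ R' ∈ relevantRadii F, R < R' := by
  obtain ⟨f, hf, rfl⟩ := exists_differentiableOn_of_mem_relevantRadii hR
  have hR0 : 0 < R := hR.1
  have han (z : ℂ) (hz : ‖z‖ < R) : AnalyticAt ℂ f z :=
    hf.analyticAt (Metric.isOpen_ball.mem_nhds (by simpa using hz))
  have hPf (z : ℂ) (hz : ‖z‖ < R) : P.evalEval z (f z) = 0 :=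
    evalEval_eq_zero_of_eval₂_taylorSeriesAt hR0 hf hP (by simpa using hz)
  have hBf (z : ℂ) (hz : ‖z‖ < R) :
      B.evalEval z (f z) * P.derivative.evalEval z (f z) = D.eval z := by
    have h0 : (B * P.derivative - Polynomial.C D).eval₂ Polynomial.coeToPowerSeries.ringHom
        (taylorSeriesAt f 0) = 0 := by
      rw [Polynomial.eval₂_sub, Polynomial.eval₂_mul, hB, Polynomial.eval₂_C]
      simp
    have := evalEval_eq_zero_of_eval₂_taylorSeriesAt hR0 hf h0 (w := z) (by simpa using hz)
    rwa [Polynomial.evalEval_sub, Polynomial.evalEval_mul, Polynomial.evalEval_C,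
      sub_eq_zero] at this
  obtain ⟨r₀, hr₀, hr₀R, hG⟩ := exists_annulus_eval_ne_zero hR0 hRD
  set A : Set ℂ := Metric.closedBall 0 R ∩ {z | r₀ ≤ ‖z‖} with hA
  have hAc : IsCompact A :=
    (isCompact_closedBall 0 R).inter_right (isClosed_le continuous_const continuous_norm)
  have hAne (z : ℂ) (hz : z ∈ A) : (P.leadingCoeff * D).eval z ≠ 0 :=
    hG z hz.2 (by simpa using hz.1)
  obtain ⟨W, hW⟩ := exists_norm_root_le (P := P) hAc fun z hz h => hAne z hz (by simp [h])
  have hAW : IsCompact (A ×ˢ Metric.closedBall (0 : ℂ) W) :=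
    hAc.prod (isCompact_closedBall 0 W)
  obtain ⟨δ, hδ⟩ := hAc.exists_bound_of_continuousOn (f := fun z => (D.eval z)⁻¹)
    (D.continuous.continuousOn.inv₀ fun z hz h => hAne z hz (by simp [h]))
  obtain ⟨β, hβ⟩ := hAW.exists_bound_of_continuousOn (continuous_evalEval B).continuousOn
  obtain ⟨K, hK⟩ := exists_continuous_coeff_bivariateTaylor P
  obtain ⟨E, hE⟩ := hAW.exists_bound_of_continuousOn
    (f := fun x => ∑ j ∈ Finset.range (P.natDegree + 2), ∑ i ∈ Finset.range K,
      ‖((bivariateTaylor P x).coeff j).coeff i‖)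
    (continuous_finsetSum _ fun j _ => continuous_finsetSum _ fun i _ =>
      (hK j i).1.norm).continuousOn
  -- Since `B * P_T = D` along the graph of `f`, `|P_T| = |D| / |B|` is at least `c` wherever `B`
  -- and `1 / D` are bounded by `β` and `δ`.
  set c : ℝ := ((|δ| + 1) * (|β| + 1))⁻¹ with hc
  obtain ⟨ρ, hρ, key⟩ := exists_geometric_bound_of_sum_eq_zero P.natDegree (c := c) (E := |E|)
    (by positivity) (abs_nonneg E)
  have hbound (z : ℂ) (h1 : r₀ ≤ ‖z‖) (h2 : ‖z‖ < R) (n : ℕ) :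
      ‖PowerSeries.coeff n (taylorSeriesAt f z)‖ * ρ ^ n ≤ max 1 W := by
    have hzA : z ∈ A := ⟨by simpa using h2.le, h1⟩
    have hfW := hW z hzA _ (hPf z h2)
    have hx : (z, f z) ∈ A ×ˢ Metric.closedBall (0 : ℂ) W := ⟨hzA, by simpa using hfW⟩
    have hconst : PowerSeries.coeff 0 (taylorSeriesAt f z) = f z := by
      simp [taylorSeriesAt]
    rcases n with _ | n
    · rw [hconst, pow_zero, mul_one]
      exact hfW.trans (le_max_right _ _)
    refine le_trans ?_ (le_max_left _ _)
    set y := taylorSeriesAt f z - PowerSeries.C (f z) with hy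
    have hcoeff : PowerSeries.coeff (n + 1) (taylorSeriesAt f z) =
        PowerSeries.coeff (n + 1) y := by
      simp [hy]
    rw [hcoeff]
    refine key (fun j => Polynomial.coeToPowerSeries.ringHom ((bivariateTaylor P (z, f z)).coeff j))
      y (fun j hj N => ?_) ?_ ?_ ?_ (n + 1)
    · refine (exists_sum_norm_coeff_le (K := K) (fun i hi => ?_) N).trans ?_
      · simpa using (hK j i).2 hi _
      · refine le_trans ?_ (((le_abs_self _).trans (hE _ hx)).trans (le_abs_self E))
        simp only [Polynomial.coeToPowerSeries.ringHom_apply, Polynomial.coeff_coe]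
        exact Finset.single_le_sum (f := fun j => ∑ i ∈ Finset.range K,
          ‖((bivariateTaylor P (z, f z)).coeff j).coeff i‖)
          (fun _ _ => Finset.sum_nonneg fun _ _ => norm_nonneg _) (Finset.mem_range.2 hj)
    · have e : PowerSeries.constantCoeff (Polynomial.coeToPowerSeries.ringHom
          ((bivariateTaylor P (z, f z)).coeff 1)) = P.derivative.evalEval z (f z) := by
        rw [← coeff_zero_coeff_one_bivariateTaylor P (z, f z)]
        simp [← PowerSeries.coeff_zero_eq_constantCoeff_apply]
      rw [e]
      have hD0 : D.eval z ≠ 0 := fun h => hAne z hzA (by simp [h])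
      have b1 : ‖(D.eval z)⁻¹‖ ≤ |δ| + 1 := by
        linarith [hδ z hzA, le_abs_self δ]
      have b2 : ‖B.evalEval z (f z)‖ ≤ |β| + 1 := by
        linarith [hβ _ hx, le_abs_self β]
      have b3 : ‖(D.eval z)⁻¹‖ * ‖B.evalEval z (f z)‖ * ‖P.derivative.evalEval z (f z)‖ = 1 := by
        rw [mul_assoc, ← norm_mul, ← norm_mul, hBf z h2, inv_mul_cancel₀ hD0, norm_one]
      have b4 : ‖(D.eval z)⁻¹‖ * ‖B.evalEval z (f z)‖ ≤ (|δ| + 1) * (|β| + 1) := by gcongr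
      rw [hc, inv_le_iff_one_le_mul₀ (by positivity), mul_comm]
      exact b3.symm.le.trans (mul_le_mul_of_nonneg_right b4 (norm_nonneg _))
    · rw [hy, map_sub, ← PowerSeries.coeff_zero_eq_constantCoeff_apply, hconst]
      simp
    · rw [← Polynomial.eval₂_eq_sum_range' Polynomial.coeToPowerSeries.ringHom
        ((natDegree_bivariateTaylor_le P (z, f z)).trans_lt (by omega)),
        eval₂_bivariateTaylor, hy, sub_add_cancel, ← taylorSeriesAt_evalEval P (han z h2)]
      have : (fun w => P.evalEval w (f w)) =ᶠ[nhds z] fun _ => 0 := by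
        filter_upwards [Metric.isOpen_ball.mem_nhds (show z ∈ Metric.ball 0 R by simpa using h2)]
          with w hw
        exact hPf w (by simpa using hw)
      rw [taylorSeriesAt_congr this, taylorSeriesAt_const, map_zero]
  -- As `ρ` does not depend on `z`, a circle inside the annulus can be taken close enough to `R`
  -- that `r + ρ > R`.
  set r := max r₀ (R - ρ / 2) with hr
  have hrR : r < R := max_lt hr₀R (by linarith)
  have hr0 : 0 < r := hr₀.trans_le (le_max_left _ _)
  refine ⟨r + ρ, mem_relevantRadii_of_norm_le (M := max 1 W) (by positivity) fun N => ?_, by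
    linarith [le_max_right r₀ (R - ρ / 2)]⟩
  exact norm_coeff_mul_add_pow_le hr0 hrR hρ hf
    (fun z hz n => hbound z (hz ▸ le_max_left _ _) (hz ▸ hrR) n) N

/-! ### Algebraic input, and the radius of an algebraic power series. -/

/-- If `s` is also a root of the derivative, pass to the derivative; in characteristic zero this
descent ends. The value `P'(s)` is algebraic and nonzero, hence has a nonzero multiple in `R` with
cofactor in `R[P'(s)]`. -/
theorem IsAlgebraic.exists_aeval_derivative_dvd {R S : Type*} [CommRing R] [IsDomain R]
    [CharZero R] [CommRing S] [IsDomain S] [Algebra R S]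
    (hinj : Function.Injective (algebraMap R S)) {s : S} (hs : IsAlgebraic R s) :
    ∃ (P B : R[X]) (D : R), P ≠ 0 ∧ D ≠ 0 ∧ Polynomial.aeval s P = 0 ∧
      Polynomial.aeval s P.derivative ≠ 0 ∧
      Polynomial.aeval s B * Polynomial.aeval s P.derivative = algebraMap R S D := by
  obtain ⟨P, hP, hPs, hPs'⟩ : ∃ P : R[X], P ≠ 0 ∧ Polynomial.aeval s P = 0 ∧
      Polynomial.aeval s P.derivative ≠ 0 := by
    obtain ⟨Q, hQ, hQs⟩ := hs
    induction h : Q.natDegree using Nat.strong_induction_on generalizing Q with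
    | _ n ih =>
      by_cases hd : Polynomial.aeval s Q.derivative = 0
      · have hn : Q.natDegree ≠ 0 := by
          intro h0
          rw [Polynomial.eq_C_of_natDegree_eq_zero h0, Polynomial.aeval_C] at hQs
          rw [Polynomial.eq_C_of_natDegree_eq_zero h0,
            (injective_iff_map_eq_zero _).1 hinj _ hQs, map_zero] at hQ
          exact hQ rfl
        exact ih _ (h ▸ Polynomial.natDegree_derivative_lt hn) Q.derivative
          (fun h0 => hn (Polynomial.derivative_eq_zero.1 h0)) hd rfl
      · exact ⟨Q, hQ, hQs, hd⟩
  have halg : IsAlgebraic R (Polynomial.aeval s P.derivative) :=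
    Algebra.isAlgebraic_adjoin_singleton_iff.2 hs _ (Polynomial.aeval_mem_adjoin_singleton R s)
  obtain ⟨t, ht, D, hD, h⟩ :=
    halg.exists_nonzero_eq_adjoin_mul (mem_nonZeroDivisors_of_ne_zero hPs')
  rw [Algebra.adjoin_singleton_eq_range_aeval] at ht
  obtain ⟨B, rfl⟩ := ht
  refine ⟨P, B.comp P.derivative, D, hP, hD, hPs, hPs', ?_⟩
  rw [Polynomial.aeval_comp, mul_comm]
  exact h

theorem norm_mem_realClosureInReal (k : Subfield ℝ) {z : ℂ} (hz : IsAlgebraic k z) :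
    ‖z‖ ∈ realClosureInReal k := by
  rw [realClosureInReal, mem_algebraicClosure_iff']
  have hconj : IsAlgebraic k ((starRingEnd ℂ) z) :=
    hz.algHom ((Complex.conjAe : ℂ →ₐ[ℝ] ℂ).restrictScalars k)
  have h2 : IsAlgebraic k (algebraMap ℝ ℂ (‖z‖ ^ 2)) := by
    have := hz.mul hconj
    rw [Complex.mul_conj, Complex.normSq_eq_norm_sq] at this
    exact this
  rw [isAlgebraic_algebraMap_iff (algebraMap ℝ ℂ).injective] at h2
  exact (IsAlgebraic.of_pow two_pos h2).isIntegral

/-- The supremum is attained because the discs are open: each point of the limit disc lies in a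
smaller disc of convergence. -/
theorem mem_relevantRadii_toReal {F : PowerSeries ℂ} (h0 : 0 < powerSeriesRadius F)
    (htop : powerSeriesRadius F ≠ ∞) : (powerSeriesRadius F).toReal ∈ relevantRadii F := by
  refine ⟨ENNReal.toReal_pos h0.ne' htop, fun z hz => ?_⟩
  rw [mem_ball_zero_iff] at hz
  have hz' : ENNReal.ofReal ‖z‖ < powerSeriesRadius F :=
    (ENNReal.ofReal_lt_iff_lt_toReal (norm_nonneg z) htop).2 hz
  obtain ⟨r, hr⟩ := lt_iSup_iff.1 hz'
  obtain ⟨hrF, hr⟩ := lt_iSup_iff.1 hr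
  exact hrF.2 z (by simpa using (ENNReal.ofReal_lt_ofReal_iff hrF.1).1 hr)

theorem ofReal_le_powerSeriesRadius {F : PowerSeries ℂ} {r : ℝ} (hr : r ∈ relevantRadii F) :
    ENNReal.ofReal r ≤ powerSeriesRadius F :=
  le_iSup₂ (f := fun r (_ : r ∈ relevantRadii F) => ENNReal.ofReal r) r hr

/-- The coefficient embedding `k[X] → ℂ[X]`. -/
noncomputable def complexify (k : Subfield ℝ) : k[X] →+* ℂ[X] :=
  Polynomial.mapRingHom (Complex.ofRealHom.comp k.subtype)

theorem complexify_injective (k : Subfield ℝ) : Function.Injective (complexify k) :=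
  Polynomial.map_injective _ (RingHom.injective _)

/-- The radius of convergence of a power series algebraic over `k[X]`. -/
theorem powerSeriesRadius_of_algebraic (k : Subfield ℝ) {F : PowerSeries ℂ} {Q : k[X][X]}
    (hQ : Q ≠ 0)
    (hQF : Q.eval₂ (Polynomial.coeToPowerSeries.ringHom.comp (complexify k)) F = 0) :
    powerSeriesRadius F = ∞ ∨
      ∃ r : ℝ, r ∈ realClosureInReal k ∧ 0 < r ∧ powerSeriesRadius F = ENNReal.ofReal r := by
  have hinj : Function.Injective
      ((Polynomial.coeToPowerSeries.ringHom : ℂ[X] →+* PowerSeries ℂ).comp (complexify k)) := by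
    rw [RingHom.coe_comp]
    exact (Polynomial.coe_injective ℂ).comp (complexify_injective k)
  obtain ⟨P, B, D, hP0, hD0, hP, hP', hB⟩ := @IsAlgebraic.exists_aeval_derivative_dvd k[X]
    (PowerSeries ℂ) _ _ _ _ _
    ((Polynomial.coeToPowerSeries.ringHom : ℂ[X] →+* PowerSeries ℂ).comp (complexify k)).toAlgebra
    hinj F ⟨Q, hQ, hQF⟩
  have hev (T : k[X][X]) : (T.map (complexify k)).eval₂ Polynomial.coeToPowerSeries.ringHom F =
      T.eval₂ (Polynomial.coeToPowerSeries.ringHom.comp (complexify k)) F :=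
    Polynomial.eval₂_map _ _ _
  replace hP := (hev P).trans hP
  have hP'' : (P.map (complexify k)).derivative.eval₂ Polynomial.coeToPowerSeries.ringHom F ≠ 0 := by
    rw [Polynomial.derivative_map, hev]
    exact hP'
  replace hB : (B.map (complexify k)).eval₂ Polynomial.coeToPowerSeries.ringHom F *
      (P.map (complexify k)).derivative.eval₂ Polynomial.coeToPowerSeries.ringHom F =
        (complexify k D : PowerSeries ℂ) := by
    rw [Polynomial.derivative_map, hev, hev]
    exact hB
  obtain ⟨ρ, hρ⟩ := exists_mem_relevantRadii hP hP''
  have hpos : 0 < powerSeriesRadius F :=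
    (ENNReal.ofReal_pos.2 hρ.1).trans_le (ofReal_le_powerSeriesRadius hρ)
  by_cases htop : powerSeriesRadius F = ∞
  · exact Or.inl htop
  right
  refine ⟨(powerSeriesRadius F).toReal, ?_, ENNReal.toReal_pos hpos.ne' htop,
    (ENNReal.ofReal_toReal htop).symm⟩
  obtain ⟨z, hz, hz0⟩ : ∃ z : ℂ, ‖z‖ = (powerSeriesRadius F).toReal ∧
      ((P.map (complexify k)).leadingCoeff * complexify k D).eval z = 0 := by
    by_contra! h
    obtain ⟨R', hR', hlt⟩ :=
      exists_mem_relevantRadii_gt (mem_relevantRadii_toReal hpos htop) hP hB h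
    have := ofReal_le_powerSeriesRadius hR'
    rw [ENNReal.ofReal_le_iff_le_toReal htop] at this
    exact absurd hlt this.not_gt
  rw [← hz]
  refine norm_mem_realClosureInReal k ⟨P.leadingCoeff * D,
    mul_ne_zero (Polynomial.leadingCoeff_ne_zero.2 hP0) hD0, ?_⟩
  rw [Polynomial.leadingCoeff_map_of_injective (complexify_injective k), ← map_mul, complexify,
    Polynomial.coe_mapRingHom, Polynomial.eval_map] at hz0
  exact hz0

/-! ### Reduction from Puiseux series to power series. -/

/-- The embedding `ℂ⟦X⟧ → ℂ((X^ℚ))` that sends `X` to `X ^ (1 / p)`. -/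
noncomputable def puiseuxEmbedding (p : ℕ) (hp : 0 < p) : PowerSeries ℂ →+* HahnSeries ℚ ℂ :=
  (HahnSeries.embDomainRingHom
    ((AddMonoidHom.mulRight ((p : ℚ)⁻¹)).comp (Nat.castAddMonoidHom ℚ))
    (fun m n h => by
      have : (p : ℚ) ≠ 0 := by positivity
      simpa [this] using h)
    (fun m n => by
      have : (0 : ℚ) < (p : ℚ)⁻¹ := by positivity
      simp [this])).comp HahnSeries.toPowerSeries.symm.toRingHom

theorem puiseuxEmbedding_injective (p : ℕ) (hp : 0 < p) :
    Function.Injective (puiseuxEmbedding p hp) := by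
  rw [puiseuxEmbedding, RingHom.coe_comp]
  exact HahnSeries.embDomain_injective.comp HahnSeries.toPowerSeries.symm.injective

theorem coeff_puiseuxEmbedding (p : ℕ) (hp : 0 < p) (F : PowerSeries ℂ) (n : ℕ) :
    (puiseuxEmbedding p hp F).coeff ((n : ℚ) / p) = PowerSeries.coeff n F := by
  rw [div_eq_mul_inv]
  exact HahnSeries.embDomain_coeff (a := n)

theorem coeff_puiseuxEmbedding_of_forall_ne (p : ℕ) (hp : 0 < p) (F : PowerSeries ℂ) {q : ℚ}
    (hq : ∀ n : ℕ, q ≠ n / p) : (puiseuxEmbedding p hp F).coeff q = 0 := by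
  refine HahnSeries.embDomain_of_notMem_range ?_
  rintro ⟨n, hn⟩
  exact hq n (by rw [← hn, div_eq_mul_inv]; rfl)

theorem puiseuxEmbedding_monomial (p : ℕ) (hp : 0 < p) (n : ℕ) (a : ℂ) :
    puiseuxEmbedding p hp (PowerSeries.monomial n a) = HahnSeries.single ((n : ℚ) / p) a := by
  have hp' : (p : ℚ) ≠ 0 := by positivity
  ext q
  by_cases h : ∃ m : ℕ, q = m / p
  · obtain ⟨m, rfl⟩ := h
    rw [coeff_puiseuxEmbedding, PowerSeries.coeff_monomial, HahnSeries.coeff_single]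
    simp [div_left_inj' hp']
  · push Not at h
    rw [coeff_puiseuxEmbedding_of_forall_ne p hp _ h, HahnSeries.coeff_single_of_ne (h n)]

theorem puiseuxEmbedding_comp_expand (k : Subfield ℝ) (p : ℕ) (hp : 0 < p) :
    ((puiseuxEmbedding p hp).comp
      (Polynomial.coeToPowerSeries.ringHom.comp (complexify k))).comp
        (Polynomial.expand k p : k[X] →+* k[X]) = polyToHahn k := by
  refine Polynomial.ringHom_ext (fun a => ?_) ?_
  · have := puiseuxEmbedding_monomial p hp 0 (a : ℝ)
    simp [polyToHahn, complexify]
    simpa using this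
  · have hp' : (p : ℚ) ≠ 0 := by positivity
    have := puiseuxEmbedding_monomial p hp p 1
    rw [← PowerSeries.X_pow_eq, div_self hp'] at this
    simp [polyToHahn, complexify]
    simpa using this

theorem mainTheorem2 (k : Subfield ℝ) (p : ℕ) (g : HahnSeries ℚ ℂ)
    (hg : IsPuiseuxSeries p g) (halg : IsAlgebraicOverPolynomials k g) :
    puiseuxRadius p g = ∞ ∨
      ∃ r : ℝ, r ∈ realClosureInReal k ∧ 0 < r ∧ puiseuxRadius p g = ENNReal.ofReal r := by
  obtain ⟨hp, l, hl⟩ := hg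
  obtain ⟨P, hP0, hP⟩ := halg
  have hp' : (p : ℚ) ≠ 0 := by positivity
  -- Multiplication by `X^(N/p)` clears the negative exponents.
  set N := (-l).toNat with hN
  set F : PowerSeries ℂ := PowerSeries.mk fun n => g.coeff (((n : ℚ) - N) / p) with hF
  have hFg : puiseuxEmbedding p hp F = HahnSeries.single ((N : ℚ) / p) 1 * g := by
    ext q
    have e : (HahnSeries.single ((N : ℚ) / p) (1 : ℂ) * g).coeff q = g.coeff (q - N / p) := by
      have := HahnSeries.coeff_single_mul_add (r := (1 : ℂ)) (x := g) (a := q - N / p)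
        (b := (N : ℚ) / p)
      rwa [sub_add_cancel, one_mul] at this
    rw [e]
    by_cases h : ∃ m : ℕ, q = m / p
    · obtain ⟨m, rfl⟩ := h
      rw [coeff_puiseuxEmbedding, hF, PowerSeries.coeff_mk, sub_div]
    · push Not at h
      rw [coeff_puiseuxEmbedding_of_forall_ne p hp _ h]
      by_contra hne
      obtain ⟨j, hj, hqj⟩ := hl _ ((HahnSeries.mem_support _ _).2 (Ne.symm hne))
      have hNj : 0 ≤ j + N := by omega
      refine h (j + N).toNat ?_
      have : (((j + N).toNat : ℕ) : ℚ) = (j : ℚ) + N := by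
        exact_mod_cast congrArg (Int.cast : ℤ → ℚ) (Int.toNat_of_nonneg hNj)
      rw [this, add_div, ← hqj, sub_add_cancel]
  set ψ := Polynomial.coeToPowerSeries.ringHom.comp (complexify k) with hψ
  -- After `X ↦ X^p`, scaling the roots by `X^N` produces an equation for the shifted series `F`.
  set Q : k[X][X] := (P.map (Polynomial.expand k p : k[X] →+* k[X])).scaleRoots
    (Polynomial.X ^ N) with hQ
  have hQ0 : Q ≠ 0 := by
    refine Polynomial.scaleRoots_ne_zero ?_ _
    exact (Polynomial.map_ne_zero_iff (f := (Polynomial.expand k p : k[X] →+* k[X]))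
      (Polynomial.expand_injective hp)).2 hP0
  have hQF : Q.eval₂ ψ F = 0 := by
    apply puiseuxEmbedding_injective p hp
    rw [map_zero, Polynomial.hom_eval₂, hFg]
    have hX : (puiseuxEmbedding p hp).comp ψ (Polynomial.X ^ N) =
        HahnSeries.single ((N : ℚ) / p) 1 := by
      rw [← puiseuxEmbedding_monomial p hp N 1, ← PowerSeries.X_pow_eq]
      simp [hψ, complexify]
    rw [← hX]
    refine Polynomial.scaleRoots_eval₂_eq_zero _ ?_
    rw [Polynomial.eval₂_map, hψ, puiseuxEmbedding_comp_expand, hP]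
  -- Dropping the first `N` coefficients of `F` leaves the nonnegative-exponent part of `g`, which
  -- defines its radius.
  have hrad : puiseuxRadius p g = powerSeriesRadius F ^ p := by
    rw [puiseuxRadius, powerSeriesRadius, powerSeriesRadius, ← relevantRadii_shift F N]
    simp [hF]
  rw [hrad]
  rcases powerSeriesRadius_of_algebraic k hQ0 hQF with h | ⟨r, hr, hr0, h⟩
  · left
    rw [h, ENNReal.top_pow hp.ne']
  · exact Or.inr ⟨r ^ p, pow_mem hr p, pow_pos hr0 p, by rw [h, ENNReal.ofReal_pow hr0.le]⟩
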